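/- Let $M$ be an oriented 3-manifold assembled from finitely many oriented truncated tetrahedra $\Delta_i$ by gluing some of their big (hexagonal) faces in pairs, by orientation-reversing maps, no face being glued to itself. The small triangles (truncated vertices) tile the small boundary of $M$, and the unglued big faces form the triangulated big boundary. Assume that $M$ is framed, that is, every component of the small boundary is a disc, an annulus or a torus. Boundaries are viewed from outside of $M$. The pairs of opposite edges of $\Delta_i$ carry parameters $z_i,z_i',z_i''\in\mathbb C^*$ with $z_iz_i'z_i''=-1$, in this counterclockwise order around every vertex. On $\mathcal P_\times=\prod_i\{z_i,z_i',z_i''\in\mathbb C^*\mid z_iz_i'z_i''=-1\}$ take the Poisson structure with $\{\log z_i,\log z_j'\}=\{\log z_i',\log z_j''\}=\{\log z_i'',\log z_j\}=\delta_{ij}$, and other brackets of logarithms of parameters of different tetrahedra equal to zero. Consider the following functions on $\mathcal P_\times$. * For every internal edge $I$ of the triangulation (an edge that lies on no unglued face), $c_I$ is the product of the parameters of all tetrahedron edges identified to $I$. For every external edge $E$, $x_E$ is the product of the parameters of all tetrahedron edges identified to $E$. * For a path $\gamma$ on the small boundary, running through the small triangles from side to side, either closed or with its endpoints on the circles that bound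 the small boundary, the path parameter $\lambda_\gamma^2$ is the product over the corners of small triangles subtended by $\gamma$ of the parameter of the corner if it is on the right of $\gamma$, and of its inverse if it is on the left; each bounce of $\gamma$ off a side contributes a factor $-1$. * Let $\langle\gamma,\gamma'\rangle$ be the algebraic intersection number of two paths, at least one of them closed, where a crossing counts $+1$ if the tangent vectors of $\gamma$ and $\gamma'$, in this order, form a counterclockwise basis, viewed from outside of $M$ (the side from which $z,z',z''$ are in counterclockwise order). For every small torus choose closed paths $\gamma_A,\gamma_B$ on it with $\langle\gamma_B,\gamma_A\rangle=1$, and put $\lambda_A^2=\lambda_{\gamma_A}^2$, $\lambda_B^2=\lambda_{\gamma_B}^2$. For every small annulus choose a closed path $\gamma_\lambda$ and an open path $\gamma_\tau$ from boundary to boundary on it with $\langle\gamma_\lambda,\gamma_\tau\rangle=1$, and put $\lambda^2=\lambda^2_{\gamma_\lambda}$, $\tau=\lambda^2_{\gamma_\tau}$. The two endpoints of $\gamma_\tau$ lie on sides of two (possibly equal) big-boundary triangles, its end triangles. For external edges $E,E'$ let $\epsilon_{EE'}$ be the number of times that $E'$ occurs to the left of $E$ in a triangle of the big boundary (looking into the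 triangle from the common vertex, viewed from outside of $M$) minus the number of times that it occurs to the right. **Theorem.** All the functions $x_E,c_I,\lambda_A^2,\lambda_B^2,\lambda^2,\tau$ are Laurent monomials in the $z_i,z_i',z_i''$, and, writing $\{\log f,\log g\}=\{f,g\}/(fg)$: 1. $\{\log x_E,\log x_{E'}\}=\epsilon_{EE'}$ for all external edges $E,E'$; every $x_E$ Poisson-commutes with all $\lambda_A^2$, $\lambda_B^2$ and $\lambda^2$ (equivalently, with local branches of $\lambda_A,\lambda_B,\lambda$), and it commutes with the twist $\tau$ of an annulus if $E$ is not an edge of an end triangle of $\gamma_\tau$. 2. $\{\log\lambda_B^2,\log\lambda_A^2\}=2$ on every small torus, and $\{\log\lambda^2,\log\tau\}=2$ on every small annulus. 3. The functions $\lambda_A^2,\lambda_B^2$ of different tori commute; the functions $\lambda_A^2,\lambda_B^2$ of a torus commute with the functions $\lambda^2,\tau$ of an annulus; for two different annuli, each $\lambda^2$ commutes with the other $\lambda^2$ and the other $\tau$, and the two twists commute if their paths have no end triangle in common. 4. The functions $c_I$ commute with each other and with all the functions $x_E,\lambda_A^2,\lambda_B^2,\lambda^2,\tau$. -/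

import Mathlib

open scoped BigOperators

/-! ### Truncated tetrahedra

The vertices of an oriented tetrahedron are `0, 1, 2, 3 : Fin 4`; the face `f` is the one opposite
to the vertex `f`.  The three pairs of opposite edges are indexed by `Fin 3`, and carry the edge
parameters `z = z₀`, `z' = z₁`, `z'' = z₂`:
type `0` is `{01, 23}`, type `1` is `{02, 13}`, type `2` is `{03, 12}`.
Around every vertex the edges of type `0, 1, 2` occur in this counterclockwise order, viewed from
outside of the tetrahedron. -/

/-- `nbr v a` is the other endpoint of the edge of type `a` at the vertex `v`. -/
def nbr (v : Fin 4) (a : Fin 3) : Fin 4 :=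
  ![![1, 2, 3], ![0, 3, 2], ![3, 0, 1], ![2, 1, 0]] v a

/-- `edgeType v w` is the type of the edge joining `v ≠ w` (the value for `v = w` is irrelevant). -/
def edgeType (v w : Fin 4) : Fin 3 :=
  ![![0, 0, 1, 2], ![0, 0, 2, 1], ![1, 2, 0, 0], ![2, 1, 0, 0]] v w

theorem edgeType_nbr (v : Fin 4) (a : Fin 3) : edgeType v (nbr v a) = a := by
  revert v a; decide

theorem nbr_edgeType (v w : Fin 4) (h : v ≠ w) : nbr v (edgeType v w) = w := by
  revert v w; decide

/-- A small triangle `(i, v)`: the truncated vertex `v` of the tetrahedron `i`. -/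
abbrev SmallTriangle (I : Type*) := I × Fin 4

/-- A big (hexagonal) face `(i, f)`: the face of the tetrahedron `i` opposite to the vertex `f`. -/
abbrev BigFace (I : Type*) := I × Fin 4

/-- A corner `(i, v, a)` of the small triangle `(i, v)`: the end at `v` of the edge of type `a`.
The corners `0, 1, 2` are in counterclockwise order, viewed from outside. -/
abbrev Corner (I : Type*) := I × Fin 4 × Fin 3

/-- A side `(i, v, b)` of the small triangle `(i, v)`: the one opposite to the corner `b`.
It lies on the big face `(i, nbr v b)`, and joins the two corners `a ≠ b`. -/
abbrev Side (I : Type*) := I × Fin 4 × Fin 3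

/-- The big face on which a side of a small triangle lies. -/
def sideFace {I : Type*} (s : Side I) : BigFace I := (s.1, nbr s.2.1 s.2.2)

/-- An oriented 3-manifold assembled from oriented truncated tetrahedra indexed by `I`, by gluing
some of the big faces in pairs.  `glue i f = none` says that the face is left unglued (it is then a
triangle of the big boundary), and `glue i f = some (j, σ)` that it is glued to the face `σ f` of
the tetrahedron `j`, each vertex `v ≠ f` of the face being glued to the vertex `σ v`.
The permutations are odd, that is, the gluing maps reverse the orientations of the faces. -/
structure TruncatedTriangulation (I : Type*) where
  glue : I → Fin 4 → Option (I × Equiv.Perm (Fin 4))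
  glue_symm : ∀ i f j σ, glue i f = some (j, σ) → glue j (σ f) = some (i, σ⁻¹)
  glue_odd : ∀ i f j σ, glue i f = some (j, σ) → Equiv.Perm.sign σ = -1
  glue_ne_self : ∀ i f j σ, glue i f = some (j, σ) → (j, σ f) ≠ (i, f)

namespace TruncatedTriangulation

variable {I : Type*} (M : TruncatedTriangulation I)

/-- The side to which a side of a small triangle is glued, if any. -/
def across (s : Side I) : Option (Side I) :=
  (M.glue s.1 (nbr s.2.1 s.2.2)).map fun g =>
    (g.1, g.2 s.2.1, edgeType (g.2 s.2.1) (g.2 (nbr s.2.1 s.2.2)))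

/-- The two corners are identified by the gluing of one side `b` adjacent to the first one. -/
def CornerGlued (c d : Corner I) : Prop :=
  ∃ (b : Fin 3) (j : I) (σ : Equiv.Perm (Fin 4)), b ≠ c.2.2 ∧
    M.glue c.1 (nbr c.2.1 b) = some (j, σ) ∧
    d = (j, σ c.2.1, edgeType (σ c.2.1) (σ (nbr c.2.1 c.2.2)))

/-! ### Edges of the triangulation and the big boundary -/

/-- Two ends of edges of tetrahedra belong to the same edge of the triangulation if they are
connected by gluings and by passing from one end of an edge of a tetrahedron to its other end. -/
def EdgeRel (c d : Corner I) : Prop :=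
  M.CornerGlued c d ∨ d = (c.1, nbr c.2.1 c.2.2, c.2.2)

/-- The edges of the triangulation of `M`. -/
def Edge : Type _ := Quot M.EdgeRel

def edgeOf (c : Corner I) : M.Edge := Quot.mk _ c

/-- The edge of type `a` of the big face `F = (i, f)`: it joins the vertices `nbr f (a + 1)` and
`nbr f (a + 2)`.  Viewed from outside of the tetrahedron, the edge of type `a + 1` of a face is to
the left of its edge of type `a` (looking into the face from their common vertex). -/
def faceEdge (F : BigFace I) (a : Fin 3) : M.Edge := M.edgeOf (F.1, nbr F.2 (a + 1), a)

/-- The big face is a triangle of the big boundary. -/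
def IsBoundaryFace (F : BigFace I) : Prop := M.glue F.1 F.2 = none

/-- External edges: the edges of the triangulation of the big boundary. -/
def IsExternal (E : M.Edge) : Prop :=
  ∃ (F : BigFace I) (a : Fin 3), M.IsBoundaryFace F ∧ M.faceEdge F a = E

def ExternalEdge : Type _ := {E : M.Edge // M.IsExternal E}

def InternalEdge : Type _ := {E : M.Edge // ¬ M.IsExternal E}

open Classical in
/-- `ε_{E,E'}`: the number of triangles of the big boundary (and pairs of sides of them) in which
`E'` is to the left of `E`, minus the number of those in which `E'` is to the right of `E`. -/
noncomputable def epsilon [Fintype I] (E E' : M.Edge) : ℤ :=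
  ∑ F : BigFace I, if M.IsBoundaryFace F then
    ∑ a : Fin 3,
      ((if M.faceEdge F a = E ∧ M.faceEdge F (a + 1) = E' then 1 else 0)
        - (if M.faceEdge F (a + 1) = E ∧ M.faceEdge F a = E' then 1 else 0))
    else 0

/-! ### The small boundary -/

/-- The connected components of the small boundary. -/
def SmallComponent : Type _ :=
  Quot fun s t : SmallTriangle I => ∃ b c : Fin 3, M.across (s.1, s.2, b) = some (t.1, t.2, c)

def componentOf (t : SmallTriangle I) : M.SmallComponent := Quot.mk _ t

/-- The vertices of the tiling of the small boundary by small triangles. -/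
def SmallVertex : Type _ := Quot M.CornerGlued

/-- The edges of the tiling of the small boundary by small triangles. -/
def SmallEdge : Type _ := Quot fun s t : Side I => M.across s = some t

/-- Euler characteristic of a component of the small boundary. -/
noncomputable def eulerChar (K : M.SmallComponent) : ℤ :=
  ({x : M.SmallVertex | ∃ c : Corner I, Quot.mk _ c = x ∧ M.componentOf (c.1, c.2.1) = K}.ncard : ℤ)
    - ({e : M.SmallEdge | ∃ s : Side I, Quot.mk _ s = e ∧ M.componentOf (s.1, s.2.1) = K}.ncard : ℤ)
    + ({t : SmallTriangle I | M.componentOf t = K}.ncard : ℤ)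

/-- The component has nonempty boundary. -/
def HasBoundary (K : M.SmallComponent) : Prop :=
  ∃ s : Side I, M.componentOf (s.1, s.2.1) = K ∧ M.across s = none

/-! Every component of the small boundary is a compact connected oriented surface, so that discs,
annuli and tori are told apart by the Euler characteristic and the boundary. -/

def IsDisc (K : M.SmallComponent) : Prop := M.eulerChar K = 1

def IsAnnulus (K : M.SmallComponent) : Prop := M.eulerChar K = 0 ∧ M.HasBoundary K

def IsTorus (K : M.SmallComponent) : Prop := M.eulerChar K = 0 ∧ ¬ M.HasBoundary K

/-- `M` is a framed 3-manifold: the components of its small boundary are discs, annuli and tori. -/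
def IsFramed : Prop := ∀ K : M.SmallComponent, M.IsDisc K ∨ M.IsAnnulus K ∨ M.IsTorus K

def Annulus : Type _ := {K : M.SmallComponent // M.IsAnnulus K}

def Torus : Type _ := {K : M.SmallComponent // M.IsTorus K}

end TruncatedTriangulation

/-! ### The product of the tetrahedron phase spaces -/

/-- The product over `i : I` of the tetrahedron phase spaces `{z, z', z'' ∈ ℂ* | z z' z'' = -1}`. -/
def PhaseSpace (I : Type*) : Type _ :=
  {z : I → Fin 3 → ℂˣ // ∀ i, z i 0 * z i 1 * z i 2 = -1}

namespace PhaseSpace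

variable {I : Type*}

noncomputable def expUnit (t : ℂ) : ℂˣ := Units.mk0 (Complex.exp t) (Complex.exp_ne_zero t)

theorem expUnit_mul (s t : ℂ) : expUnit s * expUnit t * expUnit (-(s + t)) = 1 := by
  ext
  simp only [expUnit, Units.val_mul, Units.val_mk0, Units.val_one]
  rw [← Complex.exp_add, ← Complex.exp_add]
  simp

open Classical in
/-- Translation of the logarithmic coordinates of the tetrahedron `i`:
`(Z, Z', Z'') ↦ (Z + s, Z' + t, Z'' - s - t)`. -/
noncomputable def shift (i : I) (s t : ℂ) (p : PhaseSpace I) : PhaseSpace I :=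
  ⟨Function.update p.1 i
      ![expUnit s * p.1 i 0, expUnit t * p.1 i 1, expUnit (-(s + t)) * p.1 i 2], by
    intro j
    by_cases h : j = i
    · subst h
      simp only [Function.update_self, Matrix.cons_val_zero, Matrix.cons_val_one, Matrix.cons_val]
      calc expUnit s * p.1 j 0 * (expUnit t * p.1 j 1) * (expUnit (-(s + t)) * p.1 j 2)
          = (expUnit s * expUnit t * expUnit (-(s + t))) * (p.1 j 0 * p.1 j 1 * p.1 j 2) := by
            simp only [mul_assoc, mul_left_comm]
        _ = -1 := by rw [expUnit_mul, p.2 j, one_mul]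
    · simp only [Function.update_of_ne h]
      exact p.2 j⟩

/-- `∂f/∂Zᵢ` in the coordinates `Zᵢ = log zᵢ`, `Zᵢ' = log zᵢ'`. -/
noncomputable def dZ (i : I) (f : PhaseSpace I → ℂ) (p : PhaseSpace I) : ℂ :=
  deriv (fun s : ℂ => f (shift i s 0 p)) 0

/-- `∂f/∂Zᵢ'` in the coordinates `Zᵢ = log zᵢ`, `Zᵢ' = log zᵢ'`. -/
noncomputable def dZ' (i : I) (f : PhaseSpace I → ℂ) (p : PhaseSpace I) : ℂ :=
  deriv (fun t : ℂ => f (shift i 0 t p)) 0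

/-- The Poisson bracket of the product symplectic structure, for which
`{Zᵢ, Zⱼ'} = {Zᵢ', Zⱼ''} = {Zᵢ'', Zⱼ} = δᵢⱼ`. -/
noncomputable def bracket [Fintype I] (f g : PhaseSpace I → ℂ) (p : PhaseSpace I) : ℂ :=
  ∑ i, (dZ i f p * dZ' i g p - dZ' i f p * dZ i g p)

/-- `{log f, log g} = {f, g} / (f g)` for nowhere vanishing functions. -/
noncomputable def logBracket [Fintype I] (f g : PhaseSpace I → ℂˣ) (p : PhaseSpace I) : ℂ :=
  bracket (fun q => (f q : ℂ)) (fun q => (g q : ℂ)) p / ((f p : ℂ) * (g p : ℂ))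

/-- The functions `f` and `g` Poisson-commute. -/
def Commute [Fintype I] (f g : PhaseSpace I → ℂˣ) : Prop := ∀ p, logBracket f g p = 0

/-- Laurent monomials in the edge parameters of the tetrahedra. -/
def IsLaurentMonomial [Fintype I] (f : PhaseSpace I → ℂˣ) : Prop :=
  ∃ n : I → Fin 3 → ℤ, ∀ p : PhaseSpace I, f p = ∏ i, ∏ a, p.1 i a ^ n i a

end PhaseSpace

namespace TruncatedTriangulation

variable {I : Type*} (M : TruncatedTriangulation I)

open Classical in
/-- The product of the parameters of all the edges of tetrahedra incident to the edge `E` of the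
triangulation.  (The condition `v < nbr v a` counts each edge of a tetrahedron once.)
It is `x_E` for an external edge, and the gluing function `c_E` for an internal edge. -/
noncomputable def edgeFunction [Fintype I] (E : M.Edge) (p : PhaseSpace I) : ℂˣ :=
  ∏ c : Corner I, if c.2.1 < nbr c.2.1 c.2.2 ∧ M.edgeOf c = E then p.1 c.1 c.2.2 else 1

end TruncatedTriangulation

/-! ### Paths on the small boundary -/

/-- A segment of a path in one small triangle.  It joins the two sides adjacent to the corner
`corner`; that corner is to the right of the segment if `right = true`, and to its left otherwise
(viewed from outside of `M`).  If `bounce = false` the segment is an arc subtending that corner.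
If `bounce = true` the segment bounces off the third side on its way, and so subtends the other two
corners, on the other hand. -/
structure PathSegment (I : Type*) where
  tet : I
  vertex : Fin 4
  corner : Fin 3
  right : Bool
  bounce : Bool

namespace PathSegment

variable {I : Type*}

/-- The small triangle that contains the segment. -/
def triangle (α : PathSegment I) : SmallTriangle I := (α.tet, α.vertex)

/-- The side by which the segment enters its small triangle. -/
def entry (α : PathSegment I) : Side I :=
  (α.tet, α.vertex, if α.right then α.corner + 1 else α.corner + 2)

/-- The side by which the segment leaves its small triangle. -/
def exit (α : PathSegment I) : Side I :=
  (α.tet, α.vertex, if α.right then α.corner + 2 else α.corner + 1)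

/-- A subtended corner contributes its edge parameter if it is to the right of the path, and the
inverse of its edge parameter if it is to the left of the path; a bounce contributes `-1`. -/
def factor (α : PathSegment I) (p : PhaseSpace I) : ℂˣ :=
  let z := p.1 α.tet
  match α.right, α.bounce with
  | true, false => z α.corner
  | false, false => (z α.corner)⁻¹
  | true, true => -((z (α.corner + 1))⁻¹ * (z (α.corner + 2))⁻¹)
  | false, true => -(z (α.corner + 1) * z (α.corner + 2))

end PathSegment

/-- A path on the small boundary, as the list of its segments. -/
abbrev SmallPath (I : Type*) := List (PathSegment I)

namespace SmallPath

variable {I : Type*}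

/-- The path parameter `λ_γ²`. -/
def param (γ : SmallPath I) (p : PhaseSpace I) : ℂˣ := (γ.map fun α => α.factor p).prod

/-- The number of times that `γ` leaves the small triangle of the side `s` by `s`, minus the number
of times that it enters this triangle by `s`. -/
def flux [DecidableEq I] (γ : SmallPath I) (s : Side I) : ℤ :=
  (γ.countP fun α => decide (α.exit = s) : ℤ) - (γ.countP fun α => decide (α.entry = s) : ℤ)

open Classical in
/-- The algebraic intersection number `⟨γ, γ'⟩` of two paths, at least one of them closed.  A
transversal crossing counts `+1` if the tangent vectors of `γ` and of `γ'`, in this order, form a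
counterclockwise basis, viewed from outside of `M`, and `-1` otherwise.

Two paths in the tiled surface can be displaced so that they only cross along the runs that they
have in common.  Each of the two ends of a run is a small triangle in which the paths
have exactly one side in common, and it contributes `1/2` or `-1/2`, according to the path that
is on the left after they part (before they meet): the sum is `±1` if the paths have exchanged
their sides along the run, and `0` otherwise. -/
noncomputable def intersection [Fintype I] (γ γ' : SmallPath I) : ℚ :=
  (∑ t : SmallTriangle I,
    ((flux γ (t.1, t.2, 0) * flux γ' (t.1, t.2, 1)
      - flux γ (t.1, t.2, 1) * flux γ' (t.1, t.2, 0) : ℤ) : ℚ)) / 2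

/-- The big faces on which the two endpoints of an open path lie. -/
def endFaces (γ : SmallPath I) : Set (BigFace I) :=
  {F | (∃ α ∈ γ.head?, sideFace α.entry = F) ∨ (∃ α ∈ γ.getLast?, sideFace α.exit = F)}

end SmallPath

namespace TruncatedTriangulation

variable {I : Type*} (M : TruncatedTriangulation I)

/-- The segment `β` continues the segment `α`. -/
def Follows (α β : PathSegment I) : Prop := M.across α.exit = some β.entry

/-- `γ` is a closed path on the component `K` of the small boundary. -/
def IsClosedPath (K : M.SmallComponent) (γ : SmallPath I) : Prop :=
  γ ≠ [] ∧ (∀ α ∈ γ, M.componentOf α.triangle = K) ∧ γ.IsChain M.Follows ∧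
    ∀ α ∈ γ.getLast?, ∀ β ∈ γ.head?, M.Follows α β

/-- `γ` is an open path on the component `K` of the small boundary, which begins and ends on the
boundary of `K`. -/
def IsOpenPath (K : M.SmallComponent) (γ : SmallPath I) : Prop :=
  γ ≠ [] ∧ (∀ α ∈ γ, M.componentOf α.triangle = K) ∧ γ.IsChain M.Follows ∧
    (∀ α ∈ γ.head?, M.across α.entry = none) ∧ (∀ α ∈ γ.getLast?, M.across α.exit = none)

/-- `E` is one of the edges of the big face `F`. -/
def IsEdgeOfFace (E : M.Edge) (F : BigFace I) : Prop := ∃ a : Fin 3, M.faceEdge F a = E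

/-- A choice of the paths that define the coordinates of the small boundary: on every small torus
an A-cycle and a B-cycle with `⟨γ_B, γ_A⟩ = 1`, and on every small annulus a closed path `len` and
an open path `twist`, from one boundary circle to the other, with `⟨γ_len, γ_twist⟩ = 1`. -/
structure BoundaryPaths [Fintype I] where
  cycleA : M.Torus → SmallPath I
  cycleB : M.Torus → SmallPath I
  cycleA_closed : ∀ T, M.IsClosedPath T.1 (cycleA T)
  cycleB_closed : ∀ T, M.IsClosedPath T.1 (cycleB T)
  cycle_intersection : ∀ T, (cycleB T).intersection (cycleA T) = 1
  len : M.Annulus → SmallPath I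
  twist : M.Annulus → SmallPath I
  len_closed : ∀ K, M.IsClosedPath K.1 (len K)
  twist_open : ∀ K, M.IsOpenPath K.1 (twist K)
  len_twist_intersection : ∀ K, (len K).intersection (twist K) = 1

namespace BoundaryPaths

variable [Fintype I] {M} (P : M.BoundaryPaths)

/-- The function `λ_A²` of a small torus. -/
def lambdaA (T : M.Torus) : PhaseSpace I → ℂˣ := (P.cycleA T).param

/-- The function `λ_B²` of a small torus. -/
def lambdaB (T : M.Torus) : PhaseSpace I → ℂˣ := (P.cycleB T).param

/-- The length function `λ²` of a small annulus. -/
def lambda (K : M.Annulus) : PhaseSpace I → ℂˣ := (P.len K).param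

/-- The twist function `τ` of a small annulus. -/
def tau (K : M.Annulus) : PhaseSpace I → ℂˣ := (P.twist K).param

end BoundaryPaths

/-- The function `x_E` of an external edge. -/
noncomputable def x [Fintype I] (E : M.ExternalEdge) : PhaseSpace I → ℂˣ := M.edgeFunction E.1

/-- The gluing function `c_E` of an internal edge. -/
noncomputable def c [Fintype I] (E : M.InternalEdge) : PhaseSpace I → ℂˣ := M.edgeFunction E.1

end TruncatedTriangulation

/-! ### Brackets of Laurent monomials -/

/-! All the functions are Laurent monomials, so their logarithmic brackets are constants: sums over
the tetrahedra of the cyclic pairing of exponents (`HasExponents.logBracket_eq`). The exponents come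
from integer weights on the corners of small triangles, summed over the four vertices of each
tetrahedron. A path puts `±1` on every corner that it subtends; an edge puts `1` on all its ends,
which yields twice the exponents of its function.

Within a tetrahedron the pairing of these sums splits into terms at a single vertex, which pair the
fluxes of the two weights in a small triangle, and terms between two vertices, which regroup by big
faces (`sum_cyclicPairing_total`). Flux changes sign across a glued side, and an
orientation-reversing gluing reverses the cyclic order of the three sides of a face, so glued faces
cancel in pairs (`facePairing_glue`, `sum_eq_sum_boundary`). There remain the triangle terms and the
unglued faces.

For two paths the triangle terms add up to twice the intersection number, and to zero on different
components; the unglued faces contribute nothing if one of the two paths has no flux through each of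
them. For an edge, whose weight agrees on glued corners, the triangle terms can also be regrouped by
big faces and cancel across gluings (`sum_trianglePairing`, `endPairing_glue`). Then everything is
concentrated on the unglued faces, where an internal edge has no weight and a closed path has no
flux, and where two edges give `4 ε`, the factor `4` undoing the two doublings. -/

/-- The cyclic symplectic pairing of the exponents of two Laurent monomials in `z, z', z''`. -/
def cyclicPairing (n m : Fin 3 → ℤ) : ℤ :=
  (n 0 * m 1 - n 1 * m 0) + (n 1 * m 2 - n 2 * m 1) + (n 2 * m 0 - n 0 * m 2)

namespace PhaseSpace

variable {I : Type*} [Fintype I]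

/-- `f` is the Laurent monomial with exponents `n`. -/
def HasExponents (f : PhaseSpace I → ℂˣ) (n : I → Fin 3 → ℤ) : Prop :=
  ∀ p : PhaseSpace I, f p = ∏ i, ∏ a, p.1 i a ^ n i a

theorem coe_expUnit_zpow (s : ℂ) (n : ℤ) : ((expUnit s ^ n : ℂˣ) : ℂ) = Complex.exp (n * s) := by
  rw [Units.val_zpow_eq_zpow_val, Complex.exp_int_mul]; rfl

/-- Since `z z' z'' = -1`, the logarithm of `z''` moves by `-(s + t)`: this is why only the
differences with the third exponent appear. -/
theorem HasExponents.apply_shift {f : PhaseSpace I → ℂˣ} {n : I → Fin 3 → ℤ}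
    (hf : HasExponents f n) (i : I) (s t : ℂ) (p : PhaseSpace I) :
    (f (shift i s t p) : ℂ)
      = Complex.exp ((n i 0 - n i 2) * s + (n i 1 - n i 2) * t) * f p := by
  classical
  have key : f (shift i s t p)
      = (expUnit s ^ n i 0 * expUnit t ^ n i 1 * expUnit (-(s + t)) ^ n i 2) * f p := by
    rw [hf, hf]
    have h : ∀ j, ∏ a, (shift i s t p).1 j a ^ n j a
        = (if j = i then expUnit s ^ n i 0 * expUnit t ^ n i 1 * expUnit (-(s + t)) ^ n i 2 else 1)
          * ∏ a, p.1 j a ^ n j a := by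
      intro j
      by_cases h : j = i
      · subst h
        simp only [shift, Function.update_self, Fin.prod_univ_three, Matrix.cons_val_zero,
          Matrix.cons_val_one, Matrix.cons_val, mul_zpow, if_true]
        simp only [mul_assoc, mul_left_comm]
      · simp [shift, h]
    rw [Finset.prod_congr rfl fun j _ => h j, Finset.prod_mul_distrib]
    simp
  rw [key]
  simp only [Units.val_mul, coe_expUnit_zpow]
  rw [← Complex.exp_add, ← Complex.exp_add]
  congr 2
  ring

theorem deriv_exp_mul_const (k c : ℂ) :
    deriv (fun s : ℂ => Complex.exp (k * s) * c) 0 = k * c := by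
  have h : HasDerivAt (fun s : ℂ => Complex.exp (k * s) * c) (Complex.exp (k * 0) * (k * 1) * c) 0 :=
    (((hasDerivAt_id (0 : ℂ)).const_mul k).cexp).mul_const c
  rw [h.deriv]
  simp

theorem HasExponents.dZ_eq {f : PhaseSpace I → ℂˣ} {n : I → Fin 3 → ℤ}
    (hf : HasExponents f n) (i : I) (p : PhaseSpace I) :
    dZ i (fun q => (f q : ℂ)) p = (n i 0 - n i 2) * f p := by
  simp only [dZ, hf.apply_shift, mul_zero, add_zero, deriv_exp_mul_const]

theorem HasExponents.dZ'_eq {f : PhaseSpace I → ℂˣ} {n : I → Fin 3 → ℤ}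
    (hf : HasExponents f n) (i : I) (p : PhaseSpace I) :
    dZ' i (fun q => (f q : ℂ)) p = (n i 1 - n i 2) * f p := by
  simp only [dZ', hf.apply_shift, mul_zero, zero_add, deriv_exp_mul_const]

/-- The determinant of the pairs `(n 0 - n 2, n 1 - n 2)` and `(m 0 - m 2, m 1 - m 2)` expands to
the cyclic pairing. Exponents are only determined up to multiples of `(1, 1, 1)` and a sign, and the
pairing does not see such a multiple. -/
theorem HasExponents.logBracket_eq {f g : PhaseSpace I → ℂˣ} {n m : I → Fin 3 → ℤ}
    (hf : HasExponents f n) (hg : HasExponents g m) (p : PhaseSpace I) :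
    logBracket f g p = ((∑ i, cyclicPairing (n i) (m i) : ℤ) : ℂ) := by
  have hfp : (f p : ℂ) ≠ 0 := (f p).ne_zero
  have hgp : (g p : ℂ) ≠ 0 := (g p).ne_zero
  rw [logBracket, div_eq_iff (mul_ne_zero hfp hgp), bracket]
  push_cast
  rw [Finset.sum_mul]
  refine Finset.sum_congr rfl fun i _ => ?_
  rw [hf.dZ_eq, hf.dZ'_eq, hg.dZ_eq, hg.dZ'_eq, cyclicPairing]
  push_cast
  ring

theorem HasExponents.mul {f g : PhaseSpace I → ℂˣ} {n m : I → Fin 3 → ℤ}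
    (hf : HasExponents f n) (hg : HasExponents g m) :
    HasExponents (fun p => f p * g p) (fun i a => n i a + m i a) := fun p => by
  simp only [hf p, hg p, zpow_add, Finset.prod_mul_distrib]

theorem hasExponents_one : HasExponents (fun _ : PhaseSpace I => 1) (fun _ _ => 0) := fun p => by
  simp

open Classical in
theorem hasExponents_zpow (i : I) (a : Fin 3) (k : ℤ) :
    HasExponents (fun p : PhaseSpace I => p.1 i a ^ k)
      (fun j b => if j = i ∧ b = a then k else 0) := fun p => by
  rw [Finset.prod_eq_single i, Finset.prod_eq_single a]
  · simp
  · intro b _ hb; simp [hb]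
  · simp
  · intro j _ hj; simp [hj]
  · simp

theorem HasExponents.isLaurentMonomial {f : PhaseSpace I → ℂˣ} {n : I → Fin 3 → ℤ}
    (h : HasExponents f n) : IsLaurentMonomial f := ⟨n, h⟩

end PhaseSpace

/-! ### Weights on the corners of small triangles -/

namespace CornerWeight

variable {I : Type*}

/-- The total weight of each parameter of a tetrahedron. -/
def total (W : Corner I → ℤ) (i : I) (a : Fin 3) : ℤ := ∑ v, W (i, v, a)

/-- The signed flux through a side of a path that subtends the corners with the given weights. -/
def flux (W : Corner I → ℤ) (s : Side I) : ℤ :=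
  W (s.1, s.2.1, s.2.2 + 1) - W (s.1, s.2.1, s.2.2 + 2)

/-- The sum of the weights of the ends of a side. -/
def endSum (W : Corner I → ℤ) (s : Side I) : ℤ :=
  W (s.1, s.2.1, s.2.2 + 1) + W (s.1, s.2.1, s.2.2 + 2)

/-- The pairing of the fluxes in a small triangle. -/
def trianglePairing (W W' : Corner I → ℤ) (t : SmallTriangle I) : ℤ :=
  flux W (t.1, t.2, 0) * flux W' (t.1, t.2, 1) - flux W (t.1, t.2, 1) * flux W' (t.1, t.2, 0)

end CornerWeight

/-- The side `b` of a big face: the side on that face of the small triangle at `nbr F b`. -/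
def faceSide {I : Type*} (F : BigFace I) (b : Fin 3) : Side I := (F.1, nbr F.2 b, b)

namespace CornerWeight

variable {I : Type*}

/-- The pairing of the fluxes through the sides of a big face. -/
def facePairing (W W' : Corner I → ℤ) (F : BigFace I) : ℤ :=
  cyclicPairing (fun b => flux W (faceSide F b)) (fun b => flux W' (faceSide F b))

/-- The pairing of end weights and fluxes along the sides of a big face. -/
def endPairing (W W' : Corner I → ℤ) (F : BigFace I) : ℤ :=
  -∑ b, endSum W (faceSide F b) * flux W' (faceSide F b)

/-! ### Local identities in one tetrahedron -/

/-- The cyclic pairing of the weights at two vertices equals `f b * f' (b + 1) - f (b + 1) * f' b`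
in terms of the fluxes, for any `b`. For a single vertex, `b = 0` gives the triangle term. For
distinct vertices, take for `b` and `b + 1` the two types other than that of the edge joining them:
the two products then belong to the two faces through that edge. -/
theorem sum_cyclicPairing_total [Fintype I] (W W' : Corner I → ℤ) :
    ∑ i, cyclicPairing (total W i) (total W' i)
      = ∑ t, trianglePairing W W' t + ∑ F, facePairing W W' F := by
  rw [Fintype.sum_prod_type, Fintype.sum_prod_type, ← Finset.sum_add_distrib]
  refine Finset.sum_congr rfl fun i _ => ?_
  simp only [cyclicPairing, total, trianglePairing, facePairing, flux, faceSide, nbr,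
    Fin.sum_univ_four, Fin.reduceAdd, Matrix.cons_val_zero, Matrix.cons_val_one, Matrix.cons_val,
    zero_add]
  ring

/-- In one triangle the fluxes add up to zero, so the pairing is `∑ b, W b * f' b`, and `W b` may be
replaced by minus the sum of the other two corner weights. Every side lies on exactly one big face,
so the sides can be regrouped by faces. -/
theorem sum_trianglePairing [Fintype I] (W W' : Corner I → ℤ) :
    ∑ t, trianglePairing W W' t = ∑ F, endPairing W W' F := by
  rw [Fintype.sum_prod_type, Fintype.sum_prod_type]
  refine Finset.sum_congr rfl fun i _ => ?_
  simp only [trianglePairing, endPairing, flux, endSum, faceSide, nbr,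
    Fin.sum_univ_four, Fin.sum_univ_three, Fin.reduceAdd, Matrix.cons_val_zero, Matrix.cons_val_one,
    Matrix.cons_val, zero_add]
  ring

end CornerWeight

/-! ### Gluings -/

theorem nbr_nbr (v : Fin 4) (a : Fin 3) : nbr (nbr v a) a = v := by
  revert v a; decide

theorem nbr_ne (v : Fin 4) (a : Fin 3) : nbr v a ≠ v := by
  revert v a; decide

theorem nbr_nbr_add_one (v : Fin 4) (a : Fin 3) : nbr (nbr v a) (a + 1) = nbr v (a + 2) := by
  revert v a; decide

theorem edgeType_comm (v w : Fin 4) : edgeType v w = edgeType w v := by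
  revert v w; decide

/-- An odd relabelling reverses the cyclic order of the edges at each vertex; `+ 2` stands for `- 1`
in `Fin 3`. -/
theorem edgeType_perm_add_one (σ : Equiv.Perm (Fin 4)) (hσ : Equiv.Perm.sign σ = -1) (v : Fin 4)
    (b : Fin 3) :
    edgeType (σ v) (σ (nbr v (b + 1))) = edgeType (σ v) (σ (nbr v b)) + 2 := by
  revert σ v b; decide

theorem eq_sub_of_add_one_eq (e : Fin 3 → Fin 3) (h : ∀ b, e (b + 1) = e b + 2) (b : Fin 3) :
    e b = e 0 - b := by
  revert e b; decide

theorem cyclicPairing_comp_sub (n m : Fin 3 → ℤ) (k : Fin 3) :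
    cyclicPairing (fun b => n (k - b)) (fun b => m (k - b)) = -cyclicPairing n m := by
  have h1 : (-1 : Fin 3) = 2 := rfl
  have h2 : (-2 : Fin 3) = 1 := rfl
  have h3 : (1 - 2 : Fin 3) = 2 := rfl
  have h4 : (2 - 1 : Fin 3) = 1 := rfl
  fin_cases k <;> simp [cyclicPairing, h1, h2, h3, h4] <;> ring

theorem cyclicPairing_neg_neg (n m : Fin 3 → ℤ) :
    cyclicPairing (fun b => -n b) (fun b => -m b) = cyclicPairing n m := by
  simp [cyclicPairing]

namespace TruncatedTriangulation

variable {I : Type*} (M : TruncatedTriangulation I)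

theorem across_eq_some {s t : Side I} (h : M.across s = some t) :
    ∃ j σ, M.glue s.1 (nbr s.2.1 s.2.2) = some (j, σ) ∧
      t = (j, σ s.2.1, edgeType (σ s.2.1) (σ (nbr s.2.1 s.2.2))) := by
  obtain ⟨⟨j, σ⟩, hg, ht⟩ := Option.map_eq_some_iff.1 h
  exact ⟨j, σ, hg, ht.symm⟩

theorem nbr_perm_edgeType (σ : Equiv.Perm (Fin 4)) (v : Fin 4) (b : Fin 3) :
    nbr (σ v) (edgeType (σ v) (σ (nbr v b))) = σ (nbr v b) :=
  nbr_edgeType _ _ fun h => nbr_ne v b (σ.injective h).symm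

theorem across_symm {s t : Side I} (h : M.across s = some t) : M.across t = some s := by
  obtain ⟨j, σ, hg, rfl⟩ := M.across_eq_some h
  have hg' := M.glue_symm _ _ _ _ hg
  simp only [across, nbr_perm_edgeType, hg', Option.map_some, Equiv.Perm.inv_def,
    Equiv.symm_apply_apply, edgeType_nbr]

theorem across_eq_none_iff (s : Side I) : M.across s = none ↔ M.IsBoundaryFace (sideFace s) := by
  simp [across, IsBoundaryFace, sideFace]

/-! ### Cancellation of glued faces -/

/-- The big face to which a big face is glued (the face itself if it is not glued). -/
def gluedFace (F : BigFace I) : BigFace I :=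
  (M.glue F.1 F.2).elim F fun g => (g.1, g.2 F.2)

theorem gluedFace_involutive : Function.Involutive M.gluedFace := by
  rintro ⟨i, f⟩
  rcases h : M.glue i f with _ | ⟨j, σ⟩
  · simp [gluedFace, h]
  · simp [gluedFace, h, M.glue_symm _ _ _ _ h]

-- Reindexing the sum over glued faces by the gluing involution replaces it by its negative, so it
-- is zero.
open Classical in
theorem sum_eq_sum_boundary [Fintype I] (A : BigFace I → ℤ)
    (hA : ∀ i f j σ, M.glue i f = some (j, σ) → A (j, σ f) = -A (i, f)) :
    ∑ F, A F = ∑ F, if M.IsBoundaryFace F then A F else 0 := by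
  set B : BigFace I → ℤ := fun F => if M.IsBoundaryFace F then 0 else A F with hB
  have h1 : ∀ F, B (M.gluedFace F) = -B F := by
    rintro ⟨i, f⟩
    rcases h : M.glue i f with _ | ⟨j, σ⟩
    · simp [hB, gluedFace, h, IsBoundaryFace]
    · simp [hB, gluedFace, h, IsBoundaryFace, M.glue_symm _ _ _ _ h, hA _ _ _ _ h]
  have h2 : ∑ F, B F = -∑ F, B F := by
    rw [← Finset.sum_neg_distrib, ← Equiv.sum_comp M.gluedFace_involutive.toPerm]
    exact Finset.sum_congr rfl fun F _ => h1 F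
  have h3 : ∑ F, A F = ∑ F, B F + ∑ F, if M.IsBoundaryFace F then A F else 0 := by
    rw [← Finset.sum_add_distrib]
    refine Finset.sum_congr rfl fun F _ => ?_
    simp only [hB]
    split_ifs <;> simp
  omega

/-- The sides of a face are glued to those of the other face in the reverse cyclic order. -/
theorem exists_faceSide_glue {i : I} {f : Fin 4} {j : I} {σ : Equiv.Perm (Fin 4)}
    (h : M.glue i f = some (j, σ)) :
    ∃ k : Fin 3, ∀ b, M.across (faceSide (i, f) b) = some (faceSide (j, σ f) (k - b)) := by
  have hσ := M.glue_odd _ _ _ _ h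
  have hb := eq_sub_of_add_one_eq (fun b => edgeType (σ f) (σ (nbr f b)))
    (edgeType_perm_add_one σ hσ f)
  refine ⟨edgeType (σ f) (σ (nbr f 0)), fun b => ?_⟩
  simp only [across, faceSide, nbr_nbr, h, Option.map_some]
  -- The side of the image face is labelled by the type of the edge from its vertex to the opposite
  -- vertex `σ f`; read from `σ f`, this label is `k - b` with `k` its value at `b = 0`.
  rw [← hb b, edgeType_comm (σ (nbr f b)), nbr_perm_edgeType]

/-- A weight of sides which changes sign under gluing. -/
def IsGlueOdd (φ : Side I → ℤ) : Prop := ∀ s t, M.across s = some t → φ t = -φ s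

/-- A weight of sides which is invariant under gluing. -/
def IsGlueEven (φ : Side I → ℤ) : Prop := ∀ s t, M.across s = some t → φ t = φ s

variable {M}

/-- The sign changes of the two fluxes compensate; the sign that is left is that of the reflection
`b ↦ k - b` of the cyclic order of the sides. -/
theorem facePairing_glue {W W' : Corner I → ℤ} (hW : M.IsGlueOdd (CornerWeight.flux W))
    (hW' : M.IsGlueOdd (CornerWeight.flux W')) {i : I} {f : Fin 4} {j : I}
    {σ : Equiv.Perm (Fin 4)} (h : M.glue i f = some (j, σ)) :
    CornerWeight.facePairing W W' (j, σ f) = -CornerWeight.facePairing W W' (i, f) := by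
  obtain ⟨k, hk⟩ := M.exists_faceSide_glue h
  have h1 : (fun b => CornerWeight.flux W (faceSide (j, σ f) (k - b)))
      = fun b => -CornerWeight.flux W (faceSide (i, f) b) := funext fun b => hW _ _ (hk b)
  have h2 : (fun b => CornerWeight.flux W' (faceSide (j, σ f) (k - b)))
      = fun b => -CornerWeight.flux W' (faceSide (i, f) b) := funext fun b => hW' _ _ (hk b)
  have h3 := cyclicPairing_comp_sub (fun b => CornerWeight.flux W (faceSide (j, σ f) b))
    (fun b => CornerWeight.flux W' (faceSide (j, σ f) b)) k
  rw [h1, h2, cyclicPairing_neg_neg] at h3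
  rw [CornerWeight.facePairing, CornerWeight.facePairing, h3, neg_neg]

/-- This sum over the sides ignores their cyclic order, so the sign comes from the single flux
factor. -/
theorem endPairing_glue {W W' : Corner I → ℤ} (hW : M.IsGlueEven (CornerWeight.endSum W))
    (hW' : M.IsGlueOdd (CornerWeight.flux W')) {i : I} {f : Fin 4} {j : I}
    {σ : Equiv.Perm (Fin 4)} (h : M.glue i f = some (j, σ)) :
    CornerWeight.endPairing W W' (j, σ f) = -CornerWeight.endPairing W W' (i, f) := by
  obtain ⟨k, hk⟩ := M.exists_faceSide_glue h
  rw [CornerWeight.endPairing, CornerWeight.endPairing, neg_inj, ← Finset.sum_neg_distrib]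
  refine (Equiv.sum_comp (Equiv.subLeft k) _).symm.trans (Finset.sum_congr rfl fun b _ => ?_)
  rw [Equiv.subLeft_apply, hW _ _ (hk b), hW' _ _ (hk b), mul_neg]

open Classical in
theorem sum_cyclicPairing_of_odd [Fintype I] {W W' : Corner I → ℤ}
    (hW : M.IsGlueOdd (CornerWeight.flux W)) (hW' : M.IsGlueOdd (CornerWeight.flux W')) :
    ∑ i, cyclicPairing (CornerWeight.total W i) (CornerWeight.total W' i)
      = ∑ t, CornerWeight.trianglePairing W W' t
        + ∑ F, if M.IsBoundaryFace F then CornerWeight.facePairing W W' F else 0 := by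
  rw [CornerWeight.sum_cyclicPairing_total, M.sum_eq_sum_boundary (CornerWeight.facePairing W W')
    fun _ _ _ _ h => facePairing_glue hW hW' h]

/-- A weight of corners which is invariant under gluing. -/
def IsGlueInvariant (M : TruncatedTriangulation I) (W : Corner I → ℤ) : Prop :=
  ∀ c d, M.CornerGlued c d → W c = W d

/-- Gluing along a side reverses its direction, so its two ends are exchanged. Hence the difference
of the end weights is odd and their sum is even. -/
theorem IsGlueInvariant.apply_across {W : Corner I → ℤ} (hW : M.IsGlueInvariant W)
    {s t : Side I} (h : M.across s = some t) :
    W (t.1, t.2.1, t.2.2 + 1) = W (s.1, s.2.1, s.2.2 + 2) ∧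
      W (t.1, t.2.1, t.2.2 + 2) = W (s.1, s.2.1, s.2.2 + 1) := by
  obtain ⟨j, σ, hg, rfl⟩ := M.across_eq_some h
  have hσ := edgeType_perm_add_one σ (M.glue_odd _ _ _ _ hg) s.2.1
  have h1 := hσ s.2.2
  have h2 := hσ (s.2.2 + 1)
  have e2 : s.2.2 + 1 + 1 = s.2.2 + 2 := by rw [add_assoc]; rfl
  have e4 : ∀ k : Fin 3, k + 2 + 2 = k + 1 := by decide
  rw [e2, h1, e4] at h2
  have n1 : ∀ k : Fin 3, k ≠ k + 1 := by decide
  have n2 : ∀ k : Fin 3, k ≠ k + 2 := by decide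
  constructor
  · rw [← h2]
    exact (hW (s.1, s.2.1, s.2.2 + 2) _ ⟨s.2.2, j, σ, n2 _, hg, rfl⟩).symm
  · rw [← h1]
    exact (hW (s.1, s.2.1, s.2.2 + 1) _ ⟨s.2.2, j, σ, n1 _, hg, rfl⟩).symm

theorem IsGlueInvariant.odd_flux {W : Corner I → ℤ} (hW : M.IsGlueInvariant W) :
    M.IsGlueOdd (CornerWeight.flux W) := fun s t h => by
  simp only [CornerWeight.flux, hW.apply_across h, neg_sub]

theorem IsGlueInvariant.even_endSum {W : Corner I → ℤ} (hW : M.IsGlueInvariant W) :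
    M.IsGlueEven (CornerWeight.endSum W) := fun s t h => by
  simp only [CornerWeight.endSum, hW.apply_across h, add_comm]

open Classical in
theorem IsGlueInvariant.sum_cyclicPairing [Fintype I] {W W' : Corner I → ℤ}
    (hW : M.IsGlueInvariant W) (hW' : M.IsGlueOdd (CornerWeight.flux W')) :
    ∑ i, cyclicPairing (CornerWeight.total W i) (CornerWeight.total W' i)
      = ∑ F, if M.IsBoundaryFace F then
          CornerWeight.endPairing W W' F + CornerWeight.facePairing W W' F else 0 := by
  rw [sum_cyclicPairing_of_odd hW.odd_flux hW', CornerWeight.sum_trianglePairing,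
    M.sum_eq_sum_boundary (CornerWeight.endPairing W W')
      fun _ _ _ _ h => endPairing_glue hW.even_endSum hW' h, ← Finset.sum_add_distrib]
  refine Finset.sum_congr rfl fun F _ => ?_
  split_ifs <;> simp

/-- Both kinds of boundary terms are bilinear in the corner weights of `W` along the face and the
fluxes of `W'` through it. This serves for an edge and a path. -/
theorem IsGlueInvariant.sum_cyclicPairing_eq_zero [Fintype I] {W W' : Corner I → ℤ}
    (hW : M.IsGlueInvariant W) (hW' : M.IsGlueOdd (CornerWeight.flux W'))
    (h : ∀ F, M.IsBoundaryFace F →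
      (∀ b, W (F.1, nbr F.2 b, b + 1) = 0 ∧ W (F.1, nbr F.2 b, b + 2) = 0) ∨
        ∀ b, CornerWeight.flux W' (faceSide F b) = 0) :
    ∑ i, cyclicPairing (CornerWeight.total W i) (CornerWeight.total W' i) = 0 := by
  classical
  rw [hW.sum_cyclicPairing hW']
  refine Finset.sum_eq_zero fun F _ => ?_
  split_ifs with hF
  · rcases h F hF with h0 | h0
    · have h1 : ∀ b, CornerWeight.flux W (faceSide F b) = 0 := fun b => by
        simp [CornerWeight.flux, faceSide, h0 b]
      have h2 : ∀ b, CornerWeight.endSum W (faceSide F b) = 0 := fun b => by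
        simp [CornerWeight.endSum, faceSide, h0 b]
      simp [CornerWeight.endPairing, CornerWeight.facePairing, cyclicPairing, h1, h2]
    · simp [CornerWeight.endPairing, CornerWeight.facePairing, cyclicPairing, h0]
  · rfl

theorem sum_cyclicPairing_of_disjoint_boundary [Fintype I] {W W' : Corner I → ℤ}
    (hW : M.IsGlueOdd (CornerWeight.flux W)) (hW' : M.IsGlueOdd (CornerWeight.flux W'))
    (h : ∀ F, M.IsBoundaryFace F → (∀ b, CornerWeight.flux W (faceSide F b) = 0) ∨
      ∀ b, CornerWeight.flux W' (faceSide F b) = 0) :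
    ∑ i, cyclicPairing (CornerWeight.total W i) (CornerWeight.total W' i)
      = ∑ t, CornerWeight.trianglePairing W W' t := by
  classical
  rw [sum_cyclicPairing_of_odd hW hW', add_eq_left]
  refine Finset.sum_eq_zero fun F _ => ?_
  split_ifs with hF
  · rcases h F hF with h0 | h0 <;> simp [CornerWeight.facePairing, cyclicPairing, h0]
  · rfl

/-! ### Edges -/

variable (M) in
open Classical in
/-- The indicator function of the corners at the ends of an edge. -/
noncomputable def edgeWeight (E : M.Edge) (c : Corner I) : ℤ := if M.edgeOf c = E then 1 else 0

theorem edgeOf_nbr (i : I) (v : Fin 4) (a : Fin 3) :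
    M.edgeOf (i, nbr v a, a) = M.edgeOf (i, v, a) :=
  (Quot.sound (r := M.EdgeRel) (a := (i, v, a)) (Or.inr rfl)).symm

theorem isGlueInvariant_edgeWeight (E : M.Edge) : M.IsGlueInvariant (M.edgeWeight E) :=
  fun c d h => by
    have : M.edgeOf c = M.edgeOf d := Quot.sound (r := M.EdgeRel) (Or.inl h)
    rw [edgeWeight, edgeWeight, this]

/-- The ends of the side `b` of a face lie on the edges `b + 1` and `b + 2` of that face. For `b +
2` the corner is the end used to define the face edge; for `b + 1` it is the opposite end. -/
theorem edgeOf_faceSide_two (F : BigFace I) (b : Fin 3) :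
    M.edgeOf (F.1, nbr F.2 b, b + 2) = M.faceEdge F (b + 2) := by
  have h : ∀ b : Fin 3, b + 2 + 1 = b := by decide
  rw [faceEdge, h]

theorem edgeOf_faceSide_one (F : BigFace I) (b : Fin 3) :
    M.edgeOf (F.1, nbr F.2 b, b + 1) = M.faceEdge F (b + 1) := by
  rw [faceEdge, ← edgeOf_nbr, nbr_nbr_add_one]
  have h : ∀ b : Fin 3, b + 1 + 1 = b + 2 := by decide
  rw [h]

-- The end pairing contributes the right-hand sum once. The face pairing contributes it three times,
-- since its three fluxes add up to zero and its three cyclic terms therefore coincide.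
open Classical in
theorem facePairing_add_endPairing_edgeWeight (E E' : M.Edge) (F : BigFace I) :
    CornerWeight.endPairing (M.edgeWeight E) (M.edgeWeight E') F
        + CornerWeight.facePairing (M.edgeWeight E) (M.edgeWeight E') F
      = 4 * ∑ a : Fin 3,
        ((if M.faceEdge F a = E ∧ M.faceEdge F (a + 1) = E' then 1 else 0)
          - (if M.faceEdge F (a + 1) = E ∧ M.faceEdge F a = E' then 1 else 0)) := by
  simp only [CornerWeight.endPairing, CornerWeight.facePairing, CornerWeight.flux,
    CornerWeight.endSum, faceSide, edgeWeight, edgeOf_faceSide_one, edgeOf_faceSide_two]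
  simp only [cyclicPairing, Fin.sum_univ_three, Fin.reduceAdd, zero_add, ite_and]
  have hm : ∀ (p q : Prop) [Decidable p] [Decidable q],
      (if p then if q then (1 : ℤ) else 0 else 0) = (if p then 1 else 0) * if q then 1 else 0 :=
    fun p q _ _ => by split_ifs <;> simp
  simp only [hm]
  ring

variable (M) in
open Classical in
/-- The exponents of the product of the parameters of the edges of tetrahedra on an edge. -/
noncomputable def edgeExponent (E : M.Edge) (i : I) (a : Fin 3) : ℤ :=
  ∑ v : Fin 4, if v < nbr v a ∧ M.edgeOf (i, v, a) = E then 1 else 0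

/-- The weight sees an edge of a tetrahedron at both of its ends, while the exponent counts it only
at the smaller one. -/
theorem two_mul_edgeExponent (E : M.Edge) (i : I) (a : Fin 3) :
    2 * M.edgeExponent E i a = CornerWeight.total (M.edgeWeight E) i a := by
  classical
  have key : ∀ v : Fin 4, (if v < nbr v a ∧ M.edgeOf (i, v, a) = E then (1 : ℤ) else 0)
      + (if nbr v a < nbr (nbr v a) a ∧ M.edgeOf (i, nbr v a, a) = E then (1 : ℤ) else 0)
      = M.edgeWeight E (i, v, a) := by
    intro v
    simp only [nbr_nbr, edgeOf_nbr, edgeWeight]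
    rcases lt_or_gt_of_ne (nbr_ne v a) with h | h <;> simp [h, h.not_gt]
  have hinv : Function.Involutive fun v => nbr v a := fun v => nbr_nbr v a
  have hs : ∑ v, (if nbr v a < nbr (nbr v a) a ∧ M.edgeOf (i, nbr v a, a) = E then (1 : ℤ) else 0)
      = ∑ v, if v < nbr v a ∧ M.edgeOf (i, v, a) = E then (1 : ℤ) else 0 :=
    Equiv.sum_comp hinv.toPerm
      fun v => if v < nbr v a ∧ M.edgeOf (i, v, a) = E then (1 : ℤ) else 0
  rw [CornerWeight.total, ← Finset.sum_congr rfl fun v _ => key v, Finset.sum_add_distrib, hs,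
    two_mul, edgeExponent]

theorem hasExponents_edgeFunction [Fintype I] (E : M.Edge) :
    PhaseSpace.HasExponents (M.edgeFunction E) (M.edgeExponent E) := by
  intro p
  simp only [edgeFunction, Fintype.prod_prod_type, edgeExponent]
  refine Finset.prod_congr rfl fun i _ => ?_
  rw [Finset.prod_comm]
  refine Finset.prod_congr rfl fun a _ => ?_
  simp only [Fin.sum_univ_four, Fin.prod_univ_four, zpow_add]
  congr <;> split_ifs <;> simp

theorem edgeWeight_faceSide_eq_zero {E : M.Edge} {F : BigFace I} (h : ¬ M.IsEdgeOfFace E F)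
    (b : Fin 3) : M.edgeWeight E (F.1, nbr F.2 b, b + 1) = 0 ∧
      M.edgeWeight E (F.1, nbr F.2 b, b + 2) = 0 := by
  have h' : ∀ a, M.faceEdge F a ≠ E := fun a ha => h ⟨a, ha⟩
  simp [edgeWeight, edgeOf_faceSide_one, edgeOf_faceSide_two, h']

end TruncatedTriangulation

/-! ### Chains -/

namespace List

variable {α : Type*} {R : α → α → Prop}

/-- Each link of the chain matches one occurrence of `p` with one of `q`; unmatched are the `q` of
the head and the `p` of the last element. -/
theorem IsChain.countP_add_countP_head {p q : α → Bool} (h : ∀ a b, R a b → p a = q b) :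
    ∀ {l : List α}, l.IsChain R →
      l.countP p + l.head?.toList.countP q = l.countP q + l.getLast?.toList.countP p
  | [], _ => rfl
  | [a], _ => by simp [add_comm]
  | a :: b :: l, hl => by
    have hl' := isChain_cons_cons.1 hl
    have ih := hl'.2.countP_add_countP_head h
    have hab := h a b hl'.1
    rw [countP_cons (l := b :: l), countP_cons (l := b :: l), getLast?_cons_cons]
    simp only [head?_cons, Option.toList_some, countP_singleton, hab] at ih ⊢
    omega

theorem IsChain.exists_right_or_mem_getLast :
    ∀ {l : List α}, l.IsChain R → ∀ a ∈ l, (∃ b, R a b) ∨ a ∈ l.getLast?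
  | [], _, a, ha => by simp at ha
  | [a], _, b, hb => by simp_all
  | a :: b :: l, hl, c, hc => by
    have hl' := isChain_cons_cons.1 hl
    rcases mem_cons.1 hc with rfl | hc
    · exact Or.inl ⟨b, hl'.1⟩
    · rw [getLast?_cons_cons]
      exact hl'.2.exists_right_or_mem_getLast c hc

theorem IsChain.exists_left_or_mem_head {l : List α} (hl : l.IsChain R) {b : α} (hb : b ∈ l) :
    (∃ a, R a b) ∨ b ∈ l.head? := by
  have h := (isChain_reverse.2 hl).exists_right_or_mem_getLast b (mem_reverse.2 hb)
  rwa [getLast?_reverse] at h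

end List

/-! ### Paths -/

namespace SmallPath

variable {I : Type*}

open Classical in
/-- The weights of the corners subtended by a path. -/
noncomputable def weight (γ : SmallPath I) (c : Corner I) : ℤ :=
  (γ.map fun α => if (α.tet, α.vertex, α.corner) = c then (if α.right then 1 else -1) else 0).sum

/-- A segment with its corner `k` on the right enters by the side `k + 1` and leaves by `k + 2`; on
the left the two sides and the sign of the weight are both reversed. -/
theorem flux_weight [DecidableEq I] (γ : SmallPath I) (s : Side I) :
    CornerWeight.flux γ.weight s = γ.flux s := by
  have e1 : ∀ k b : Fin 3, k + 2 = b ↔ k = b + 1 := by decide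
  have e2 : ∀ k b : Fin 3, k + 1 = b ↔ k = b + 2 := by decide
  have n1 : ∀ b : Fin 3, b + 1 ≠ b + 2 := by decide
  induction γ with
  | nil => simp [CornerWeight.flux, weight, SmallPath.flux]
  | cons α γ ih =>
    obtain ⟨i, v, b⟩ := s
    simp only [CornerWeight.flux, weight, SmallPath.flux, List.map_cons, List.sum_cons,
      List.countP_cons, PathSegment.exit, PathSegment.entry, Prod.mk.injEq, decide_eq_true_eq,
      Nat.cast_add] at ih ⊢
    rw [add_sub_add_comm, ih, add_comm, add_sub_add_comm]
    congr 1
    rcases α with ⟨j, w, k, r, bo⟩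
    by_cases hj : j = i <;> by_cases hw : w = v <;> cases r <;> simp [hj, hw, e1, e2]
    all_goals split_ifs <;> simp

theorem exists_of_flux_ne_zero [DecidableEq I] {γ : SmallPath I} {s : Side I}
    (h : γ.flux s ≠ 0) : ∃ α ∈ γ, α.exit = s ∨ α.entry = s := by
  by_contra! hn
  refine h ?_
  rw [SmallPath.flux, List.countP_eq_zero.2, List.countP_eq_zero.2]
  · rfl
  · simpa using fun α hα => (hn α hα).2
  · simpa using fun α hα => (hn α hα).1

end SmallPath

theorem mul_cyclic {G : Type*} [CommMonoid G] (z : Fin 3 → G) (k : Fin 3) :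
    z k * (z (k + 1) * z (k + 2)) = z 0 * z 1 * z 2 := by
  fin_cases k
  · exact (mul_assoc _ _ _).symm
  · change z 1 * (z 2 * z 0) = _
    rw [← mul_assoc, mul_comm, mul_assoc]
  · change z 2 * (z 0 * z 1) = _
    rw [mul_comm]

/-- By `z z' z'' = -1`, a bounce has the same factor as the arc around the remaining corner: the
factor `-1` of a bounce is what makes this true, so bounces need no weights of their own. -/
theorem PathSegment.factor_eq {I : Type*} (α : PathSegment I) (p : PhaseSpace I) :
    α.factor p = p.1 α.tet α.corner ^ (if α.right then (1 : ℤ) else -1) := by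
  have hp : p.1 α.tet α.corner * (p.1 α.tet (α.corner + 1) * p.1 α.tet (α.corner + 2)) = -1 := by
    exact (mul_cyclic _ _).trans (p.2 α.tet)
  rcases α with ⟨i, v, k, r, b⟩
  simp only at hp
  cases r <;> cases b <;> simp only [factor, if_true, Bool.false_eq_true, if_false, zpow_one,
    zpow_neg]
  · rw [eq_inv_iff_mul_eq_one, mul_comm, mul_neg, hp, neg_neg]
  · rw [eq_comm, ← mul_inv, ← inv_neg, eq_inv_iff_mul_eq_one, mul_neg, hp, neg_neg]

namespace SmallPath

variable {I : Type*} [Fintype I]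

theorem hasExponents_param (γ : SmallPath I) :
    PhaseSpace.HasExponents γ.param (CornerWeight.total γ.weight) := by
  classical
  induction γ with
  | nil => intro p; simp [param, CornerWeight.total, weight]
  | cons α γ ih =>
    have h := (PhaseSpace.hasExponents_zpow α.tet α.corner
      (if α.right then (1 : ℤ) else -1)).mul ih
    convert h using 1
    · funext p
      simp only [param, List.map_cons, List.prod_cons, PathSegment.factor_eq]
    · funext i a
      simp only [CornerWeight.total, weight, List.map_cons, List.sum_cons,
        Finset.sum_add_distrib, Prod.mk.injEq, add_left_inj]
      by_cases hi : α.tet = i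
      · by_cases ha : α.corner = a
        · simp [hi, ha]
        · simp [ha, Ne.symm ha]
      · simp [hi, Ne.symm hi]

theorem two_mul_intersection (γ γ' : SmallPath I) :
    2 * γ.intersection γ' = ((∑ t, CornerWeight.trianglePairing γ.weight γ'.weight t : ℤ) : ℚ) := by
  classical
  rw [intersection, mul_div_cancel₀ _ two_ne_zero]
  push_cast
  refine Finset.sum_congr rfl fun t _ => ?_
  rw [CornerWeight.trianglePairing]
  simp only [flux_weight]
  push_cast
  congr!

end SmallPath

/-! ### Conservation of flux along paths -/

namespace TruncatedTriangulation

variable {I : Type*} {M : TruncatedTriangulation I}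

/-- Leaving a triangle through a glued side means entering its neighbour through the matching side,
so exits by `s` and entries by `t` balance up to the two ends of the path, which `h` controls. For a
closed path the last segment is followed by the first; for an open one both ends are on unglued
sides. -/
theorem isGlueOdd_flux_of_isChain {γ : SmallPath I} (hγ : γ.IsChain M.Follows)
    (h : ∀ s t, M.across s = some t → ∀ (p q : PathSegment I → Bool),
      (∀ α, p α = true ↔ α.exit = s) → (∀ α, q α = true ↔ α.entry = t) →
      γ.head?.toList.countP q = γ.getLast?.toList.countP p) :
    M.IsGlueOdd (CornerWeight.flux γ.weight) := by
  classical
  have key : ∀ s t, M.across s = some t →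
      γ.countP (fun α => decide (α.exit = s)) = γ.countP (fun α => decide (α.entry = t)) := by
    intro s t hst
    have h1 := hγ.countP_add_countP_head (p := fun α => decide (α.exit = s))
      (q := fun α => decide (α.entry = t)) fun α β hαβ => by
        refine decide_eq_decide.2 ⟨?_, ?_⟩
        · rintro rfl
          exact Option.some.inj (hαβ.symm.trans hst)
        · rintro rfl
          exact Option.some.inj ((M.across_symm hαβ).symm.trans (M.across_symm hst))
    have h2 := h s t hst (fun α => decide (α.exit = s)) (fun α => decide (α.entry = t))
      (by simp) (by simp)
    omega
  intro s t hst
  rw [SmallPath.flux_weight, SmallPath.flux_weight, SmallPath.flux, SmallPath.flux,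
    key s t hst, key t s (M.across_symm hst), neg_sub]

variable {K : M.SmallComponent} {γ : SmallPath I}

theorem IsClosedPath.isGlueOdd_flux (h : M.IsClosedPath K γ) :
    M.IsGlueOdd (CornerWeight.flux γ.weight) := by
  obtain ⟨hne, -, hc, hlast⟩ := h
  refine isGlueOdd_flux_of_isChain hc fun s t hst p q hp hq => ?_
  have hf := hlast _ (List.getLast?_eq_getLast_of_ne_nil hne) _ (List.head?_eq_some_head hne)
  rw [List.getLast?_eq_getLast_of_ne_nil hne, List.head?_eq_some_head hne]
  have : q (γ.head hne) = p (γ.getLast hne) := by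
    rw [Bool.eq_iff_iff, hp, hq]
    constructor
    · rintro rfl
      exact Option.some.inj ((M.across_symm hf).symm.trans (M.across_symm hst))
    · rintro rfl
      exact Option.some.inj (hf.symm.trans hst)
  simp [List.countP_singleton, this]

theorem IsOpenPath.isGlueOdd_flux (h : M.IsOpenPath K γ) :
    M.IsGlueOdd (CornerWeight.flux γ.weight) := by
  obtain ⟨-, -, hc, hhead, hlast⟩ := h
  refine isGlueOdd_flux_of_isChain hc fun s t hst p q hp hq => ?_
  rw [List.countP_eq_zero.2, List.countP_eq_zero.2]
  · intro α hα hpα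
    rw [Option.mem_toList] at hα
    have := hlast α hα
    rw [(hp α).1 hpα, hst] at this
    cases this
  · intro α hα hqα
    rw [Option.mem_toList] at hα
    have := hhead α hα
    rw [(hq α).1 hqα, M.across_symm hst] at this
    cases this

/-- Every segment of a closed path has a successor and a predecessor, so all the sides that it uses
are glued. -/
theorem IsClosedPath.flux_eq_zero (h : M.IsClosedPath K γ) {s : Side I}
    (hs : M.across s = none) : CornerWeight.flux γ.weight s = 0 := by
  classical
  obtain ⟨hne, -, hc, hlast⟩ := h
  have hf := hlast _ (List.getLast?_eq_getLast_of_ne_nil hne) _ (List.head?_eq_some_head hne)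
  rw [SmallPath.flux_weight]
  by_contra hn
  obtain ⟨α, hα, rfl | rfl⟩ := SmallPath.exists_of_flux_ne_zero hn
  · rcases hc.exists_right_or_mem_getLast α hα with ⟨β, hβ⟩ | hl
    · cases hs.symm.trans hβ
    · cases hs.symm.trans (hlast α hl _ (List.head?_eq_some_head hne))
  · rcases hc.exists_left_or_mem_head hα with ⟨β, hβ⟩ | hl
    · cases hs.symm.trans (M.across_symm hβ)
    · cases hs.symm.trans
        (M.across_symm (hlast _ (List.getLast?_eq_getLast_of_ne_nil hne) α hl))

theorem IsOpenPath.flux_eq_zero (h : M.IsOpenPath K γ) {s : Side I}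
    (hs : M.across s = none) (hF : sideFace s ∉ γ.endFaces) :
    CornerWeight.flux γ.weight s = 0 := by
  classical
  obtain ⟨-, -, hc, -, -⟩ := h
  rw [SmallPath.flux_weight]
  by_contra hn
  obtain ⟨α, hα, rfl | rfl⟩ := SmallPath.exists_of_flux_ne_zero hn
  · rcases hc.exists_right_or_mem_getLast α hα with ⟨β, hβ⟩ | hl
    · cases hs.symm.trans hβ
    · exact hF (Or.inr ⟨α, hl, rfl⟩)
  · rcases hc.exists_left_or_mem_head hα with ⟨β, hβ⟩ | hl
    · cases hs.symm.trans (M.across_symm hβ)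
    · exact hF (Or.inl ⟨α, hl, rfl⟩)

theorem across_faceSide {F : BigFace I} (hF : M.IsBoundaryFace F) (b : Fin 3) :
    M.across (faceSide F b) = none := by
  rw [across_eq_none_iff]
  simpa only [sideFace, faceSide, nbr_nbr] using hF

theorem IsClosedPath.flux_faceSide (h : M.IsClosedPath K γ) {F : BigFace I}
    (hF : M.IsBoundaryFace F) (b : Fin 3) : CornerWeight.flux γ.weight (faceSide F b) = 0 :=
  h.flux_eq_zero (across_faceSide hF b)

theorem IsOpenPath.flux_faceSide (h : M.IsOpenPath K γ) {F : BigFace I}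
    (hF : M.IsBoundaryFace F) (hγ : F ∉ γ.endFaces) (b : Fin 3) :
    CornerWeight.flux γ.weight (faceSide F b) = 0 :=
  h.flux_eq_zero (across_faceSide hF b) <| by
    simpa only [sideFace, faceSide, nbr_nbr] using hγ

/-- No small triangle has flux of both paths, because they run on different components. -/
theorem sum_trianglePairing_eq_zero [Fintype I] {K K' : M.SmallComponent} {γ γ' : SmallPath I}
    (hγ : ∀ α ∈ γ, M.componentOf α.triangle = K) (hγ' : ∀ α ∈ γ', M.componentOf α.triangle = K')
    (hK : K ≠ K') : ∑ t, CornerWeight.trianglePairing γ.weight γ'.weight t = 0 := by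
  classical
  have key : ∀ (K : M.SmallComponent) (γ : SmallPath I),
      (∀ α ∈ γ, M.componentOf α.triangle = K) → ∀ t : SmallTriangle I, M.componentOf t ≠ K →
      ∀ b, CornerWeight.flux γ.weight (t.1, t.2, b) = 0 := by
    intro K γ hγ t ht b
    rw [SmallPath.flux_weight]
    by_contra hn
    obtain ⟨α, hα, h | h⟩ := SmallPath.exists_of_flux_ne_zero hn <;>
    · simp only [PathSegment.exit, PathSegment.entry, Prod.mk.injEq] at h
      refine ht ?_
      rw [← hγ α hα, PathSegment.triangle, h.1, h.2.1]
  refine Finset.sum_eq_zero fun t _ => ?_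
  rw [CornerWeight.trianglePairing]
  by_cases ht : M.componentOf t = K
  · simp [key K' γ' hγ' t fun h => hK (ht.symm.trans h)]
  · simp [key K γ hγ t ht]

theorem not_isEdgeOfFace_of_not_isExternal {E : M.Edge} (hE : ¬ M.IsExternal E) {F : BigFace I}
    (hF : M.IsBoundaryFace F) : ¬ M.IsEdgeOfFace E F :=
  fun ⟨a, ha⟩ => hE ⟨F, a, hF, ha⟩

theorem Torus.ne_annulus (T : M.Torus) (K : M.Annulus) : T.1 ≠ K.1 :=
  fun h => T.2.2 (h ▸ K.2.2)

/-! ### The brackets -/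

variable [Fintype I]

theorem cyclicPairing_two_mul_left (n m : Fin 3 → ℤ) :
    cyclicPairing (fun a => 2 * n a) m = 2 * cyclicPairing n m := by
  simp only [cyclicPairing]; ring

theorem cyclicPairing_two_mul_right (n m : Fin 3 → ℤ) :
    cyclicPairing n (fun a => 2 * m a) = 2 * cyclicPairing n m := by
  simp only [cyclicPairing]; ring

theorem two_mul_sum_cyclicPairing_edgeExponent (E : M.Edge) (m : I → Fin 3 → ℤ) :
    2 * ∑ i, cyclicPairing (M.edgeExponent E i) (m i)
      = ∑ i, cyclicPairing (CornerWeight.total (M.edgeWeight E) i) (m i) := by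
  rw [Finset.mul_sum]
  refine Finset.sum_congr rfl fun i _ => ?_
  rw [← cyclicPairing_two_mul_left]
  simp only [two_mul_edgeExponent]

theorem four_mul_sum_cyclicPairing_edgeExponent (E E' : M.Edge) :
    4 * ∑ i, cyclicPairing (M.edgeExponent E i) (M.edgeExponent E' i)
      = ∑ i, cyclicPairing (CornerWeight.total (M.edgeWeight E) i)
          (CornerWeight.total (M.edgeWeight E') i) := by
  rw [← two_mul_sum_cyclicPairing_edgeExponent, show (4 : ℤ) = 2 * 2 from rfl, mul_assoc]
  congr 1
  rw [Finset.mul_sum]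
  refine Finset.sum_congr rfl fun i _ => ?_
  rw [← cyclicPairing_two_mul_right]
  simp only [two_mul_edgeExponent]

theorem logBracket_edgeFunction_edgeFunction (E E' : M.Edge) (p : PhaseSpace I) :
    PhaseSpace.logBracket (M.edgeFunction E) (M.edgeFunction E') p = (M.epsilon E E' : ℂ) := by
  classical
  rw [(hasExponents_edgeFunction E).logBracket_eq (hasExponents_edgeFunction E'), Int.cast_inj]
  have h := (isGlueInvariant_edgeWeight E).sum_cyclicPairing
    (isGlueInvariant_edgeWeight E').odd_flux
  rw [← four_mul_sum_cyclicPairing_edgeExponent] at h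
  -- One factor `2` comes from each of the two doubled exponents.
  refine mul_left_cancel₀ (four_ne_zero (α := ℤ)) (h.trans ?_)
  rw [epsilon, Finset.mul_sum]
  refine Finset.sum_congr rfl fun F _ => ?_
  rw [facePairing_add_endPairing_edgeWeight, mul_ite, mul_zero]

theorem logBracket_edgeFunction_param {E : M.Edge} {γ : SmallPath I}
    (hγ : M.IsGlueOdd (CornerWeight.flux γ.weight))
    (h : ∀ F, M.IsBoundaryFace F → ¬ M.IsEdgeOfFace E F ∨
      ∀ b, CornerWeight.flux γ.weight (faceSide F b) = 0) (p : PhaseSpace I) :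
    PhaseSpace.logBracket (M.edgeFunction E) γ.param p = 0 := by
  rw [(hasExponents_edgeFunction E).logBracket_eq γ.hasExponents_param, Int.cast_eq_zero]
  have h0 := (isGlueInvariant_edgeWeight E).sum_cyclicPairing_eq_zero hγ fun F hF =>
    (h F hF).imp_left edgeWeight_faceSide_eq_zero
  rw [← two_mul_sum_cyclicPairing_edgeExponent] at h0
  simpa using h0

theorem commute_edgeFunction_of_isClosedPath (E : M.Edge) (h : M.IsClosedPath K γ) :
    PhaseSpace.Commute (M.edgeFunction E) γ.param :=
  logBracket_edgeFunction_param h.isGlueOdd_flux fun _ hF => Or.inr (h.flux_faceSide hF)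

theorem commute_edgeFunction_of_isOpenPath {E : M.Edge} (h : M.IsOpenPath K γ)
    (hE : ∀ F ∈ γ.endFaces, M.IsBoundaryFace F → ¬ M.IsEdgeOfFace E F) :
    PhaseSpace.Commute (M.edgeFunction E) γ.param :=
  logBracket_edgeFunction_param h.isGlueOdd_flux fun F hF => by
    by_cases hγ : F ∈ γ.endFaces
    · exact Or.inl (hE F hγ hF)
    · exact Or.inr (h.flux_faceSide hF hγ)

theorem commute_edgeFunction_edgeFunction_of_not_isExternal {E : M.Edge} (hE : ¬ M.IsExternal E)
    (E' : M.Edge) : PhaseSpace.Commute (M.edgeFunction E) (M.edgeFunction E') := fun p => by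
  rw [logBracket_edgeFunction_edgeFunction, Int.cast_eq_zero, epsilon]
  refine Finset.sum_eq_zero fun F _ => ?_
  split_ifs with hF
  · have h : ∀ a, M.faceEdge F a ≠ E := fun a ha =>
      not_isEdgeOfFace_of_not_isExternal hE hF ⟨a, ha⟩
    simp [h]
  · rfl

/-! ### Brackets of two path parameters -/

theorem logBracket_param_param {γ γ' : SmallPath I}
    (hγ : M.IsGlueOdd (CornerWeight.flux γ.weight))
    (hγ' : M.IsGlueOdd (CornerWeight.flux γ'.weight))
    (h : ∀ F, M.IsBoundaryFace F → (∀ b, CornerWeight.flux γ.weight (faceSide F b) = 0) ∨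
      ∀ b, CornerWeight.flux γ'.weight (faceSide F b) = 0) (p : PhaseSpace I) :
    PhaseSpace.logBracket γ.param γ'.param p
      = ((∑ t, CornerWeight.trianglePairing γ.weight γ'.weight t : ℤ) : ℂ) := by
  rw [γ.hasExponents_param.logBracket_eq γ'.hasExponents_param,
    sum_cyclicPairing_of_disjoint_boundary hγ hγ' h]

/-- The bracket of the parameters of a closed path and of another path is twice their intersection
number. -/
theorem IsClosedPath.logBracket_param_eq_two (h : M.IsClosedPath K γ) {γ' : SmallPath I}
    (hγ' : M.IsGlueOdd (CornerWeight.flux γ'.weight)) (p : PhaseSpace I)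
    (hi : γ.intersection γ' = 1) : PhaseSpace.logBracket γ.param γ'.param p = 2 := by
  rw [logBracket_param_param h.isGlueOdd_flux hγ' fun F hF => Or.inl (h.flux_faceSide hF)]
  have h2 := SmallPath.two_mul_intersection γ γ'
  rw [hi, mul_one] at h2
  have h3 : (2 : ℤ) = ∑ t, CornerWeight.trianglePairing γ.weight γ'.weight t := by exact_mod_cast h2
  rw [← h3]
  norm_num

theorem IsClosedPath.commute_param (h : M.IsClosedPath K γ) {K' : M.SmallComponent}
    {γ' : SmallPath I} (hγ' : M.IsGlueOdd (CornerWeight.flux γ'.weight))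
    (hK' : ∀ α ∈ γ', M.componentOf α.triangle = K') (hK : K ≠ K') :
    PhaseSpace.Commute γ.param γ'.param := fun p => by
  rw [logBracket_param_param h.isGlueOdd_flux hγ' fun F hF => Or.inl (h.flux_faceSide hF),
    sum_trianglePairing_eq_zero h.2.1 hK' hK, Int.cast_zero]

theorem IsOpenPath.commute_param (h : M.IsOpenPath K γ) {K' : M.SmallComponent}
    {γ' : SmallPath I} (h' : M.IsOpenPath K' γ') (hK : K ≠ K')
    (hd : Disjoint γ.endFaces γ'.endFaces) : PhaseSpace.Commute γ.param γ'.param := fun p => by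
  rw [logBracket_param_param h.isGlueOdd_flux h'.isGlueOdd_flux,
    sum_trianglePairing_eq_zero h.2.1 h'.2.1 hK, Int.cast_zero]
  intro F hF
  by_cases hγ : F ∈ γ.endFaces
  -- An unglued face that carries an endpoint of `γ` carries none of `γ'`, so at least one of the
  -- fluxes vanishes on each face.
  · exact Or.inr (h'.flux_faceSide hF (Set.disjoint_left.1 hd hγ))
  · exact Or.inl (h.flux_faceSide hF hγ)

end TruncatedTriangulation

theorem mainTheorem1 {I : Type*} [Fintype I] (M : TruncatedTriangulation I)
    (hM : M.IsFramed) (P : M.BoundaryPaths) :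
    -- all the functions are Laurent monomials in the edge parameters of the tetrahedra
    ((∀ E, PhaseSpace.IsLaurentMonomial (M.x E)) ∧
      (∀ E, PhaseSpace.IsLaurentMonomial (M.c E)) ∧
      (∀ T, PhaseSpace.IsLaurentMonomial (P.lambdaA T) ∧
        PhaseSpace.IsLaurentMonomial (P.lambdaB T)) ∧
      (∀ K, PhaseSpace.IsLaurentMonomial (P.lambda K) ∧
        PhaseSpace.IsLaurentMonomial (P.tau K))) ∧
    -- brackets of the big boundary coordinates
    (∀ E E' p, PhaseSpace.logBracket (M.x E) (M.x E') p = (M.epsilon E.1 E'.1 : ℂ)) ∧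
    -- brackets of the big boundary coordinates with those of tori and annuli
    (∀ E T, PhaseSpace.Commute (M.x E) (P.lambdaA T) ∧
      PhaseSpace.Commute (M.x E) (P.lambdaB T)) ∧
    (∀ E K, PhaseSpace.Commute (M.x E) (P.lambda K)) ∧
    (∀ E K, (∀ F ∈ (P.twist K).endFaces, ¬ M.IsEdgeOfFace E.1 F) →
      PhaseSpace.Commute (M.x E) (P.tau K)) ∧
    -- brackets on one torus, and on one annulus
    (∀ T p, PhaseSpace.logBracket (P.lambdaB T) (P.lambdaA T) p = 2) ∧
    (∀ K p, PhaseSpace.logBracket (P.lambda K) (P.tau K) p = 2) ∧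
    -- different tori
    (∀ T T', T ≠ T' → PhaseSpace.Commute (P.lambdaA T) (P.lambdaA T') ∧
      PhaseSpace.Commute (P.lambdaA T) (P.lambdaB T') ∧
      PhaseSpace.Commute (P.lambdaB T) (P.lambdaB T')) ∧
    -- different annuli
    (∀ K K', K ≠ K' → PhaseSpace.Commute (P.lambda K) (P.lambda K') ∧
      PhaseSpace.Commute (P.lambda K) (P.tau K') ∧
      (Disjoint (P.twist K).endFaces (P.twist K').endFaces →
        PhaseSpace.Commute (P.tau K) (P.tau K'))) ∧
    -- a torus and an annulus
    (∀ T K, PhaseSpace.Commute (P.lambdaA T) (P.lambda K) ∧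
      PhaseSpace.Commute (P.lambdaA T) (P.tau K) ∧
      PhaseSpace.Commute (P.lambdaB T) (P.lambda K) ∧
      PhaseSpace.Commute (P.lambdaB T) (P.tau K)) ∧
    -- the gluing functions of the internal edges
    (∀ E E', PhaseSpace.Commute (M.c E) (M.c E')) ∧
    (∀ E E', PhaseSpace.Commute (M.c E) (M.x E')) ∧
    (∀ E T, PhaseSpace.Commute (M.c E) (P.lambdaA T) ∧
      PhaseSpace.Commute (M.c E) (P.lambdaB T)) ∧
    (∀ E K, PhaseSpace.Commute (M.c E) (P.lambda K) ∧
      PhaseSpace.Commute (M.c E) (P.tau K)) := by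

  have hT : ∀ T T' : M.Torus, T ≠ T' → T.1 ≠ T'.1 := fun _ _ h e => h (Subtype.ext e)
  have hK : ∀ K K' : M.Annulus, K ≠ K' → K.1 ≠ K'.1 := fun _ _ h e => h (Subtype.ext e)
  open TruncatedTriangulation in
  refine ⟨⟨fun E => (hasExponents_edgeFunction E.1).isLaurentMonomial,
      fun E => (hasExponents_edgeFunction E.1).isLaurentMonomial,
      fun T => ⟨(SmallPath.hasExponents_param _).isLaurentMonomial,
        (SmallPath.hasExponents_param _).isLaurentMonomial⟩,
      fun K => ⟨(SmallPath.hasExponents_param _).isLaurentMonomial,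
        (SmallPath.hasExponents_param _).isLaurentMonomial⟩⟩,
    fun E E' => logBracket_edgeFunction_edgeFunction E.1 E'.1,
    fun E T => ⟨commute_edgeFunction_of_isClosedPath _ (P.cycleA_closed T),
      commute_edgeFunction_of_isClosedPath _ (P.cycleB_closed T)⟩,
    fun E K => commute_edgeFunction_of_isClosedPath _ (P.len_closed K),
    fun E K h => commute_edgeFunction_of_isOpenPath (P.twist_open K) fun F hF _ => h F hF,
    fun T p => (P.cycleB_closed T).logBracket_param_eq_two (P.cycleA_closed T).isGlueOdd_flux p
      (P.cycle_intersection T),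
    fun K p => (P.len_closed K).logBracket_param_eq_two (P.twist_open K).isGlueOdd_flux p
      (P.len_twist_intersection K),
    fun T T' h => ⟨?_, ?_, ?_⟩, fun K K' h => ⟨?_, ?_, ?_⟩, fun T K => ⟨?_, ?_, ?_, ?_⟩,
    fun E E' => commute_edgeFunction_edgeFunction_of_not_isExternal E.2 E'.1,
    fun E E' => commute_edgeFunction_edgeFunction_of_not_isExternal E.2 E'.1,
    fun E T => ⟨commute_edgeFunction_of_isClosedPath _ (P.cycleA_closed T),
      commute_edgeFunction_of_isClosedPath _ (P.cycleB_closed T)⟩,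
    fun E K => ⟨commute_edgeFunction_of_isClosedPath _ (P.len_closed K),
      commute_edgeFunction_of_isOpenPath (P.twist_open K) fun F _ hF =>
        not_isEdgeOfFace_of_not_isExternal E.2 hF⟩⟩
  · exact (P.cycleA_closed T).commute_param (P.cycleA_closed T').isGlueOdd_flux
      (P.cycleA_closed T').2.1 (hT _ _ h)
  · exact (P.cycleA_closed T).commute_param (P.cycleB_closed T').isGlueOdd_flux
      (P.cycleB_closed T').2.1 (hT _ _ h)
  · exact (P.cycleB_closed T).commute_param (P.cycleB_closed T').isGlueOdd_flux
      (P.cycleB_closed T').2.1 (hT _ _ h)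
  · exact (P.len_closed K).commute_param (P.len_closed K').isGlueOdd_flux
      (P.len_closed K').2.1 (hK _ _ h)
  · exact (P.len_closed K).commute_param (P.twist_open K').isGlueOdd_flux
      (P.twist_open K').2.1 (hK _ _ h)
  · exact (P.twist_open K).commute_param (P.twist_open K') (hK _ _ h)
  · exact (P.cycleA_closed T).commute_param (P.len_closed K).isGlueOdd_flux
      (P.len_closed K).2.1 (T.ne_annulus K)
  · exact (P.cycleA_closed T).commute_param (P.twist_open K).isGlueOdd_flux
      (P.twist_open K).2.1 (T.ne_annulus K)
  · exact (P.cycleB_closed T).commute_param (P.len_closed K).isGlueOdd_flux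
      (P.len_closed K).2.1 (T.ne_annulus K)
  · exact (P.cycleB_closed T).commute_param (P.twist_open K).isGlueOdd_flux
      (P.twist_open K).2.1 (T.ne_annulus K)
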